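/- All graphs are finite, undirected and simple. Let $G=(V,E)$ be a connected graph with distance function $d$. A set $D\subseteq V$ is dominating if every vertex of $V\setminus D$ has a neighbour in $D$; a set $S\subseteq V$ is locating if for every two distinct vertices $u,v\in V$ there is $x\in S$ with $d(u,x)\neq d(v,x)$. Let $\gamma(G)$ (domination number), $\beta(G)$ (metric dimension) and $\eta(G)$ (metric-location-domination number) be the minimum cardinality of a dominating set, of a locating set, and of a set that is both locating and dominating, respectively. Theorem. Let $a,b,c$ be positive integers with $\max\{a,b\}\le c\le a+b$. If it is not the case that $1=b<a<c=a+1$, then there is a finite connected graph $G$ with $\gamma(G)=a$, $\beta(G)=b$ and $\eta(G)=c$. If $1=b<a<c=a+1$, then no finite connected graph $G$ satisfies $\gamma(G)=a$, $\beta(G)=b$ and $\eta(G)=c$. -/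

import Mathlib

namespace CodeGraph

/-- `D` is a dominating set of `G`: every vertex outside `D` has a neighbour in `D`. -/
def IsDominating {V : Type*} (G : SimpleGraph V) (D : Finset V) : Prop :=
  ∀ v : V, v ∉ D → (G.neighborSet v ∩ (D : Set V)).Nonempty

/-- The metric coordinates of the vertex `v` with respect to `S`:
the family of distances from `v` to the vertices of `S`. -/
noncomputable def metricCoord {V : Type*} (G : SimpleGraph V) (S : Finset V) (v : V) :
    {x : V // x ∈ S} → ℕ :=
  fun x => G.dist v (x : V)

/-- `S` is a locating set of the (connected) graph `G`: distinct vertices have distinct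
metric coordinates with respect to `S`. -/
def IsLocating {V : Type*} (G : SimpleGraph V) (S : Finset V) : Prop :=
  ∀ u v : V, u ≠ v → metricCoord G S u ≠ metricCoord G S v

/-- A metric-locating-dominating set: a set which is both locating and dominating. -/
def IsMetricLocatingDominating {V : Type*} (G : SimpleGraph V) (S : Finset V) : Prop :=
  IsLocating G S ∧ IsDominating G S

/-- The domination number `γ(G)` of a finite graph: the minimum cardinality of a dominating set
(the set of all vertices is one, so the minimum is attained). -/
noncomputable def dominationNumber {V : Type*} (G : SimpleGraph V) : ℕ :=
  sInf {n : ℕ | ∃ D : Finset V, IsDominating G D ∧ D.card = n}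

/-- The metric dimension `β(G)` of a finite connected graph:
the minimum cardinality of a locating set. -/
noncomputable def metricDimension {V : Type*} (G : SimpleGraph V) : ℕ :=
  sInf {n : ℕ | ∃ S : Finset V, IsLocating G S ∧ S.card = n}

/-- The metric-location-domination number `η(G)` of a finite connected graph:
the minimum cardinality of a metric-locating-dominating set. -/
noncomputable def metricLocationDominationNumber {V : Type*} (G : SimpleGraph V) : ℕ :=
  sInf {n : ℕ | ∃ S : Finset V, IsMetricLocatingDominating G S ∧ S.card = n}

end CodeGraph

/-! If β = 1, distances to a single vertex identify `G` with a path, and any two vertices of a path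
locate. A minimum dominating set with at least two vertices is then already locating, so η = γ; this
excludes the exceptional triples. The main construction is a caterpillar: a path of `a` spine
vertices, the `i`-th carrying `r i + 1` pendant vertices that form either a clique or an independent
set ("star"). Pendant vertices of one branch are twins, so locating costs `r i` per branch; a star
branch costs one more when domination is also required, a clique branch with `r i > 0` does not.
Thus γ = `a`, β = ∑ `r i`, η = β + (number of star branches). Locating at this cost uses a landmark
in both end branches, so for `1 < a` it needs `1 < b`. Complete graphs, stars and paths on `3 * a`
vertices cover `a = 1` or `b = 1`. -/

namespace CodeGraph

/-! ### General facts on locating and dominating sets -/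

section General

variable {V W : Type*} {G : SimpleGraph V} {H : SimpleGraph W}

theorem sInf_card_eq {P : Finset V → Prop} {k : ℕ} (hex : ∃ D, P D ∧ D.card = k)
    (hle : ∀ D, P D → k ≤ D.card) : sInf {n : ℕ | ∃ D : Finset V, P D ∧ D.card = n} = k := by
  refine IsLeast.csInf_eq ⟨hex, ?_⟩
  rintro n ⟨D, hD, rfl⟩
  exact hle D hD

theorem exists_card_eq_sInf {P : Finset V → Prop} (hex : ∃ D, P D) :
    ∃ D, P D ∧ D.card = sInf {n : ℕ | ∃ D : Finset V, P D ∧ D.card = n} := by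
  obtain ⟨D, hD⟩ := hex
  exact Nat.sInf_mem (s := {n : ℕ | ∃ D : Finset V, P D ∧ D.card = n}) ⟨_, D, hD, rfl⟩

theorem sInf_card_le {P : Finset V → Prop} {D : Finset V} (hD : P D) :
    sInf {n : ℕ | ∃ D : Finset V, P D ∧ D.card = n} ≤ D.card :=
  Nat.sInf_le ⟨D, hD, rfl⟩

theorem isDominating_iff {D : Finset V} :
    IsDominating G D ↔ ∀ v, v ∉ D → ∃ w ∈ D, G.Adj v w := by
  simp only [IsDominating, Set.Nonempty, Set.mem_inter_iff, SimpleGraph.mem_neighborSet,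
    Finset.mem_coe, and_comm]

theorem isLocating_iff {S : Finset V} :
    IsLocating G S ↔ ∀ u v, u ≠ v → ∃ x ∈ S, G.dist u x ≠ G.dist v x := by
  simp only [IsLocating, metricCoord, ne_eq, funext_iff, Subtype.forall, not_forall,
    exists_prop]

theorem IsLocating.mono {S T : Finset V} (hS : IsLocating G S) (hST : S ⊆ T) :
    IsLocating G T := by
  rw [isLocating_iff] at *
  intro u v huv
  obtain ⟨x, hx, h⟩ := hS u v huv
  exact ⟨x, hST hx, h⟩

/-- Vertices of `S` separate themselves from all others. -/
theorem isLocating_of_notMem (hG : G.Connected) {S : Finset V}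
    (h : ∀ u ∉ S, ∀ v ∉ S, u ≠ v → ∃ x ∈ S, G.dist u x ≠ G.dist v x) : IsLocating G S := by
  rw [isLocating_iff]
  intro u v huv
  by_cases hu : u ∈ S
  · exact ⟨u, hu, by simpa using (hG.pos_dist_of_ne huv.symm).ne⟩
  by_cases hv : v ∈ S
  · exact ⟨v, hv, by simpa using (hG.pos_dist_of_ne huv).ne'⟩
  exact h u hu v hv huv

theorem _root_.SimpleGraph.Iso.dist_apply_le (φ : G ≃g H) (hG : G.Connected) (u v : V) :
    H.dist (φ u) (φ v) ≤ G.dist u v := by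
  obtain ⟨p, hp⟩ := hG.exists_walk_length_eq_dist u v
  rw [← hp, ← SimpleGraph.Walk.length_map φ.toHom p]
  exact SimpleGraph.dist_le _

theorem _root_.SimpleGraph.Iso.dist_apply (φ : G ≃g H) (hG : G.Connected) (u v : V) :
    H.dist (φ u) (φ v) = G.dist u v := by
  refine (φ.dist_apply_le hG u v).antisymm ?_
  simpa using φ.symm.dist_apply_le (φ.connected_iff.1 hG) (φ u) (φ v)

theorem IsDominating.map (φ : G ≃g H) {D : Finset V} (hD : IsDominating G D) :
    IsDominating H (D.map φ.toEquiv.toEmbedding) := by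
  rw [isDominating_iff] at *
  intro v hv
  obtain ⟨w, hw, hadj⟩ := hD (φ.symm v) fun h => hv <| Finset.mem_map.2 ⟨_, h, by simp⟩
  refine ⟨φ w, Finset.mem_map.2 ⟨w, hw, rfl⟩, ?_⟩
  simpa using φ.map_adj_iff.2 hadj

theorem IsLocating.map (φ : G ≃g H) (hG : G.Connected) {S : Finset V} (hS : IsLocating G S) :
    IsLocating H (S.map φ.toEquiv.toEmbedding) := by
  rw [isLocating_iff] at *
  intro u v huv
  obtain ⟨x, hx, h⟩ := hS (φ.symm u) (φ.symm v) (by simpa using huv)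
  refine ⟨φ x, Finset.mem_map.2 ⟨x, hx, rfl⟩, ?_⟩
  rwa [← φ.dist_apply hG, ← φ.dist_apply hG, φ.apply_symm_apply, φ.apply_symm_apply] at h

theorem sInf_card_congr {P : Finset V → Prop} {Q : Finset W → Prop} (e : V ≃ W)
    (h₁ : ∀ D, P D → Q (D.map e.toEmbedding)) (h₂ : ∀ D, Q D → P (D.map e.symm.toEmbedding)) :
    sInf {n : ℕ | ∃ D : Finset V, P D ∧ D.card = n} =
      sInf {n : ℕ | ∃ D : Finset W, Q D ∧ D.card = n} := by
  congr 1
  ext n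
  constructor
  · rintro ⟨D, hD, rfl⟩
    exact ⟨_, h₁ D hD, by simp⟩
  · rintro ⟨D, hD, rfl⟩
    exact ⟨_, h₂ D hD, by simp⟩

/-- `G` is connected with domination number `a`, metric dimension `b` and
metric-location-domination number `c`. -/
def HasNumbers (G : SimpleGraph V) (a b c : ℕ) : Prop :=
  G.Connected ∧ dominationNumber G = a ∧ metricDimension G = b ∧
    metricLocationDominationNumber G = c

theorem HasNumbers.of_iso {a b c : ℕ} (h : HasNumbers G a b c) (φ : G ≃g H) :
    HasNumbers H a b c := by
  obtain ⟨hG, ha, hb, hc⟩ := h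
  have hH := φ.connected_iff.1 hG
  refine ⟨hH, ha ▸ (sInf_card_congr φ.toEquiv ?_ ?_).symm,
    hb ▸ (sInf_card_congr φ.toEquiv ?_ ?_).symm, hc ▸ (sInf_card_congr φ.toEquiv ?_ ?_).symm⟩
  · exact fun D hD => hD.map φ
  · exact fun D hD => hD.map φ.symm
  · exact fun D hD => hD.map φ hG
  · exact fun D hD => hD.map φ.symm hH
  · exact fun D hD => ⟨hD.1.map φ hG, hD.2.map φ⟩
  · exact fun D hD => ⟨hD.1.map φ.symm hH, hD.2.map φ.symm⟩

theorem HasNumbers.exists_fin [Fintype V] {a b c : ℕ} (h : HasNumbers G a b c) :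
    ∃ (n : ℕ) (G' : SimpleGraph (Fin n)), HasNumbers G' a b c :=
  ⟨_, _, h.of_iso (SimpleGraph.Iso.map (Fintype.equivFin V) G)⟩

theorem hasNumbers_of {a b c : ℕ} (hG : G.Connected)
    (ha : ∃ D, IsDominating G D ∧ D.card = a) (ha' : ∀ D, IsDominating G D → a ≤ D.card)
    (hb : ∃ D, IsLocating G D ∧ D.card = b) (hb' : ∀ D, IsLocating G D → b ≤ D.card)
    (hc : ∃ D, IsMetricLocatingDominating G D ∧ D.card = c)
    (hc' : ∀ D, IsMetricLocatingDominating G D → c ≤ D.card) : HasNumbers G a b c :=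
  ⟨hG, sInf_card_eq ha ha', sInf_card_eq hb hb', sInf_card_eq hc hc'⟩

/-- Two vertices with the same neighbours, apart from each other, cannot both be missed by a
locating set. -/
theorem IsLocating.eq_of_twins (hG : G.Connected) {S : Finset V} (hS : IsLocating G S) {u v : V}
    (hu : u ∉ S) (hv : v ∉ S) (h : ∀ w, w ≠ u → w ≠ v → (G.Adj u w ↔ G.Adj v w)) : u = v := by
  classical
  by_contra huv
  -- Swapping the twins is an automorphism fixing `S` pointwise, so it preserves distances to `S`.
  have hswap : ∀ x y, G.Adj (Equiv.swap u v x) (Equiv.swap u v y) ↔ G.Adj x y := by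
    intro x y
    have := h x
    have := h y
    by_cases hxu : x = u <;> by_cases hxv : x = v <;> by_cases hyu : y = u <;>
      by_cases hyv : y = v <;>
      simp_all [Equiv.swap_apply_of_ne_of_ne, G.adj_comm]
  let φ : G ≃g G := ⟨Equiv.swap u v, fun {x y} => hswap x y⟩
  obtain ⟨x, hx, hne⟩ := isLocating_iff.1 hS u v huv
  apply hne
  have h1 : φ v = u := Equiv.swap_apply_right u v
  have h2 : φ x = x := Equiv.swap_apply_of_ne_of_ne (fun h => hu (h ▸ hx)) (fun h => hv (h ▸ hx))
  rw [← φ.dist_apply hG v x, h1, h2]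

/-- A function `f` that vanishes only at `x`, changes by at most one along edges and can always
be decreased along an edge is the distance to `x`. -/
theorem reachable_and_dist_eq {x : V} {f : V → ℕ} (hx : f x = 0)
    (hlip : ∀ u v, G.Adj u v → f u ≤ f v + 1)
    (hdec : ∀ v, v ≠ x → ∃ w, G.Adj v w ∧ f w + 1 = f v) (v : V) :
    G.Reachable v x ∧ G.dist v x = f v := by
  have hwalk : ∀ n v, f v = n → ∃ p : G.Walk v x, p.length = n := by
    intro n
    induction n with
    | zero =>
      intro v hv
      by_cases h : v = x
      · subst h
        exact ⟨.nil, rfl⟩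
      · obtain ⟨w, -, hw⟩ := hdec v h
        omega
    | succ n ih =>
      intro v hv
      obtain ⟨w, hadj, hw⟩ := hdec v (by rintro rfl; omega)
      obtain ⟨p, hp⟩ := ih w (by omega)
      exact ⟨.cons hadj p, by simp [hp]⟩
  have hlen : ∀ {u w : V} (p : G.Walk u w), f u ≤ f w + p.length := by
    intro u w p
    induction p with
    | nil => simp
    | cons h p ih =>
      have := hlip _ _ h
      rw [SimpleGraph.Walk.length_cons]
      omega
  obtain ⟨p, hp⟩ := hwalk _ v rfl
  refine ⟨p.reachable, (hp ▸ SimpleGraph.dist_le p).antisymm ?_⟩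
  obtain ⟨q, hq⟩ := p.reachable.exists_walk_length_eq_dist
  have := hlen q
  omega

/-! ### Graphs of metric dimension one -/

/-- If distances to `x` determine the vertices, then `G` is isometric to a path. -/
theorem dist_eq_sub_of_injective (hG : G.Connected) {x : V}
    (hinj : Function.Injective fun v => G.dist v x) (u v : V) (huv : G.dist u x ≤ G.dist v x) :
    G.dist v u = G.dist v x - G.dist u x := by
  have hstep : ∀ n u v, G.dist v x = G.dist u x + n → G.dist v u ≤ n := by
    intro n
    induction n with
    | zero =>
      intro u v h
      obtain rfl : v = u := hinj h
      simp
    | succ n ih =>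
      intro u v h
      -- Each step of a geodesic to `x` lowers the distance by one; by injectivity the geodesic must
      -- pass through `u`.
      obtain ⟨p, hp⟩ := hG.exists_walk_length_eq_dist v x
      cases p with
      | nil => rw [SimpleGraph.dist_self] at h; omega
      | @cons _ w _ hadj p =>
        have h1 := SimpleGraph.dist_le p
        have h2 : G.dist v x ≤ G.dist v w + G.dist w x := hG.dist_triangle
        have h3 : G.dist v w = 1 := SimpleGraph.dist_eq_one_iff_adj.2 hadj
        have h4 : G.dist v u ≤ G.dist v w + G.dist w u := hG.dist_triangle
        rw [SimpleGraph.Walk.length_cons] at hp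
        have := ih u w (by omega)
        omega
  have h1 := hstep (G.dist v x - G.dist u x) u v (by omega)
  have h2 : G.dist v x ≤ G.dist v u + G.dist u x := hG.dist_triangle
  omega

/-- If a single vertex locates, then so does every set with at least two vertices. -/
theorem isLocating_of_one_lt_card (hG : G.Connected) {x : V} (hx : IsLocating G {x})
    {S : Finset V} (hS : 1 < S.card) : IsLocating G S := by
  have hinj : Function.Injective fun v => G.dist v x := by
    intro u v h
    by_contra hne
    obtain ⟨y, hy, h'⟩ := isLocating_iff.1 hx u v hne
    rw [Finset.mem_singleton.1 hy] at h'
    exact h' h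
  have hdist := dist_eq_sub_of_injective hG hinj
  -- The two truncated differences add up to an absolute value.
  have habs : ∀ u v, G.dist u v =
      (G.dist u x - G.dist v x) + (G.dist v x - G.dist u x) := by
    intro u v
    rcases le_total (G.dist u x) (G.dist v x) with h | h
    · rw [SimpleGraph.dist_comm, hdist u v h]
      omega
    · rw [hdist v u h]
      omega
  obtain ⟨p, hp, q, hq, hpq⟩ := Finset.one_lt_card.1 hS
  rw [isLocating_iff]
  intro u v huv
  -- Distinct points of a line are equidistant only from their midpoint, which cannot be both `p`
  -- and `q`.
  by_contra! hcon
  have hp' := hcon p hp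
  have hq' := hcon q hq
  rw [habs u p, habs v p] at hp'
  rw [habs u q, habs v q] at hq'
  have h1 : G.dist u x ≠ G.dist v x := hinj.ne huv
  have h2 : G.dist p x ≠ G.dist q x := hinj.ne hpq
  omega

theorem metricLocationDominationNumber_eq_of_metricDimension_eq_one [Finite V]
    (hG : G.Connected) (hb : metricDimension G = 1) (ha : 1 < dominationNumber G) :
    metricLocationDominationNumber G = dominationNumber G := by
  have := Fintype.ofFinite V
  obtain ⟨S, hS, hS1⟩ := exists_card_eq_sInf (P := IsLocating G)
    ⟨Finset.univ, isLocating_of_notMem hG fun u hu => absurd (Finset.mem_univ u) hu⟩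
  obtain ⟨x, rfl⟩ := Finset.card_eq_one.1 (hS1.trans hb)
  obtain ⟨D, hD, hDc⟩ := exists_card_eq_sInf (P := IsDominating G)
    ⟨Finset.univ, fun v hv => absurd (Finset.mem_univ v) hv⟩
  change D.card = dominationNumber G at hDc
  refine sInf_card_eq ⟨D, ⟨isLocating_of_one_lt_card hG hS (by omega), hD⟩, hDc⟩ ?_
  exact fun E hE => sInf_card_le hE.2

theorem IsLocating.nonempty [Nontrivial V] {S : Finset V} (hS : IsLocating G S) :
    S.Nonempty := by
  obtain ⟨u, v, huv⟩ := exists_pair_ne V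
  obtain ⟨x, hx, -⟩ := isLocating_iff.1 hS u v huv
  exact ⟨x, hx⟩

end General

/-! ### Complete graphs and paths -/

theorem hasNumbers_top {b : ℕ} (hb : 0 < b) :
    HasNumbers (⊤ : SimpleGraph (Fin (b + 1))) 1 b b := by
  have hG : (⊤ : SimpleGraph (Fin (b + 1))).Connected := SimpleGraph.connected_top
  have hdom : ∀ D : Finset (Fin (b + 1)), D.Nonempty → IsDominating ⊤ D := by
    rintro D ⟨w, hw⟩
    exact isDominating_iff.2 fun v hv => ⟨w, hw, fun h => hv (h ▸ hw)⟩
  have hloc : IsLocating (⊤ : SimpleGraph (Fin (b + 1))) (Finset.univ.erase 0) := by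
    refine isLocating_of_notMem hG fun u hu v hv huv => ?_
    simp only [Finset.mem_erase, Finset.mem_univ, and_true, not_not] at hu hv
    exact absurd (hu.trans hv.symm) huv
  have hcard : (Finset.univ.erase (0 : Fin (b + 1))).card = b := by simp
  have hle : ∀ S : Finset (Fin (b + 1)), IsLocating ⊤ S → b ≤ S.card := by
    intro S hS
    have h : Sᶜ.card ≤ 1 := Finset.card_le_one.2 fun u hu v hv =>
      hS.eq_of_twins hG (Finset.mem_compl.1 hu) (Finset.mem_compl.1 hv)
        fun w h1 h2 => by simp [h1.symm, h2.symm]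
    rw [Finset.card_compl, Fintype.card_fin] at h
    omega
  refine hasNumbers_of hG ⟨{0}, hdom _ (by simp), by simp⟩ ?_ ⟨_, hloc, hcard⟩ hle
    ⟨_, ⟨hloc, hdom _ (Finset.card_pos.1 (by omega))⟩, hcard⟩ fun S hS => hle S hS.1
  intro D hD
  rw [Nat.succ_le_iff, Finset.card_pos]
  by_contra h
  rw [Finset.not_nonempty_iff_eq_empty] at h
  obtain ⟨w, hw, -⟩ := isDominating_iff.1 hD 0 (by simp [h])
  simp [h] at hw

theorem hasNumbers_pathGraph {a : ℕ} (ha : 1 < a) :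
    HasNumbers (SimpleGraph.pathGraph (3 * a)) a 1 a := by
  have : Nontrivial (Fin (3 * a)) := Fin.nontrivial_iff_two_le.2 (by omega)
  let x : Fin (3 * a) := ⟨0, by omega⟩
  have hdist := reachable_and_dist_eq (G := SimpleGraph.pathGraph (3 * a)) (x := x)
    (f := fun v => v.val) rfl
    (by intro u v h; rw [SimpleGraph.pathGraph_adj] at h; omega)
    (by
      intro v hv
      have hv0 : v.val ≠ 0 := fun h => hv (Fin.ext h)
      refine ⟨⟨v.val - 1, by omega⟩, ?_, ?_⟩
      · rw [SimpleGraph.pathGraph_adj]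
        right
        change v.val - 1 + 1 = v.val
        omega
      · change v.val - 1 + 1 = v.val
        omega)
  have hG : (SimpleGraph.pathGraph (3 * a)).Connected := by
    have : Nonempty (Fin (3 * a)) := ⟨x⟩
    exact ⟨fun u v => (hdist u).1.trans (hdist v).1.symm⟩
  have hx : IsLocating (SimpleGraph.pathGraph (3 * a)) {x} := by
    refine isLocating_iff.2 fun u v huv => ⟨x, by simp, ?_⟩
    rw [(hdist u).2, (hdist v).2]
    exact fun h => huv (Fin.ext h)
  have hγ : dominationNumber (SimpleGraph.pathGraph (3 * a)) = a := by
    refine sInf_card_eq ?_ ?_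
    · refine ⟨Finset.univ.map ⟨fun i : Fin a => (⟨3 * i.val + 1, by omega⟩ : Fin (3 * a)), ?_⟩,
        ?_, by simp⟩
      · intro i j h
        simp only [Fin.mk.injEq] at h
        exact Fin.ext (by omega)
      · rw [isDominating_iff]
        intro v hv
        refine ⟨⟨3 * (v.val / 3) + 1, by omega⟩, ?_, ?_⟩
        · exact Finset.mem_map.2 ⟨⟨v.val / 3, by omega⟩, by simp, rfl⟩
        · have hne : 3 * (v.val / 3) + 1 ≠ v.val := fun h =>
            hv (Finset.mem_map.2 ⟨⟨v.val / 3, by omega⟩, by simp, Fin.ext h⟩)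
          rw [SimpleGraph.pathGraph_adj]
          change v.val + 1 = 3 * (v.val / 3) + 1 ∨ 3 * (v.val / 3) + 1 + 1 = v.val
          omega
    · intro D hD
      -- The closed neighbourhoods of the vertices `3 * i` are disjoint, and `(w + 1) / 3` equals
      -- `i` on each; `% a` only forces the value into `Fin a`.
      have hsub : (Finset.univ : Finset (Fin a)) ⊆
          D.image fun v => (⟨(v.val + 1) / 3 % a, Nat.mod_lt _ (by omega)⟩ : Fin a) := by
        intro i _
        rw [Finset.mem_image]
        obtain ⟨w, hw, hwi⟩ : ∃ w ∈ D, (w.val + 1) / 3 = i.val := by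
          by_cases hi : (⟨3 * i.val, by omega⟩ : Fin (3 * a)) ∈ D
          · exact ⟨_, hi, by change (3 * i.val + 1) / 3 = i.val; omega⟩
          · obtain ⟨w, hw, hadj⟩ := isDominating_iff.1 hD _ hi
            refine ⟨w, hw, ?_⟩
            rw [SimpleGraph.pathGraph_adj] at hadj
            change 3 * i.val + 1 = w.val ∨ w.val + 1 = 3 * i.val at hadj
            omega
        exact ⟨w, hw, Fin.ext (by simp [hwi, Nat.mod_eq_of_lt i.isLt])⟩
      simpa using (Finset.card_le_card hsub).trans Finset.card_image_le
  have hβ : metricDimension (SimpleGraph.pathGraph (3 * a)) = 1 :=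
    sInf_card_eq ⟨_, hx, by simp⟩ fun S hS => hS.nonempty.card_pos
  refine ⟨hG, hγ, hβ, ?_⟩
  rw [metricLocationDominationNumber_eq_of_metricDimension_eq_one hG hβ (by omega), hγ]


/-! ### Caterpillars -/

/-- Vertices of a caterpillar with spine `Fin a` and `r i + 1` pendant vertices at `i`:
`⟨i, none⟩` is the spine vertex and `⟨i, some j⟩` are the pendant ones. -/
abbrev CaterpillarVertex {a : ℕ} (r : Fin a → ℕ) : Type :=
  Σ i : Fin a, Option (Fin (r i + 1))

/-- The adjacency relation of `caterpillar`. -/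
def CaterpillarAdj {a : ℕ} (r : Fin a → ℕ) (star : Finset (Fin a)) :
    CaterpillarVertex r → CaterpillarVertex r → Prop
  | ⟨i, none⟩, ⟨j, none⟩ => i.val + 1 = j.val ∨ j.val + 1 = i.val
  | ⟨i, none⟩, ⟨j, some _⟩ => i = j
  | ⟨i, some _⟩, ⟨j, none⟩ => i = j
  | ⟨i, some x⟩, ⟨j, some y⟩ => i = j ∧ i ∉ star ∧ x.val ≠ y.val

/-- A path on `Fin a` with `r i + 1` additional vertices attached to its `i`-th vertex; they are
independent for `i ∈ star` and pairwise adjacent for the other `i`. -/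
def caterpillar {a : ℕ} (r : Fin a → ℕ) (star : Finset (Fin a)) :
    SimpleGraph (CaterpillarVertex r) where
  Adj := CaterpillarAdj r star
  symm := ⟨by
    rintro ⟨i, _ | x⟩ ⟨j, _ | y⟩ h
    · exact Or.symm h
    · exact Eq.symm h
    · exact Eq.symm h
    · obtain ⟨rfl, h1, h2⟩ := h
      exact ⟨rfl, h1, h2.symm⟩⟩
  loopless := ⟨by
    rintro ⟨i, _ | x⟩ h
    · simp [CaterpillarAdj] at h
    · exact h.2.2 rfl⟩

section Caterpillar

variable {a : ℕ} {r : Fin a → ℕ} {star : Finset (Fin a)}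

/-- The distance to the pendant vertex `⟨e, some k⟩`. -/
def pendantDist (r : Fin a → ℕ) (star : Finset (Fin a)) (e : Fin a) (k : ℕ) :
    CaterpillarVertex r → ℕ
  | ⟨i, none⟩ => (i.val - e.val) + (e.val - i.val) + 1
  | ⟨i, some x⟩ =>
    if i = e then if x.val = k then 0 else if i ∈ star then 2 else 1
    else (i.val - e.val) + (e.val - i.val) + 2

theorem caterpillar_dist (e : Fin a) (k : Fin (r e + 1)) (v : CaterpillarVertex r) :
    (caterpillar r star).Reachable v ⟨e, some k⟩ ∧
      (caterpillar r star).dist v ⟨e, some k⟩ = pendantDist r star e k v := by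
  refine reachable_and_dist_eq (by simp [pendantDist]) ?_ ?_ v
  · rintro ⟨i, _ | x⟩ ⟨j, _ | y⟩ h
    · change _ ∨ _ at h
      simp only [pendantDist]
      omega
    · obtain rfl : i = j := h
      simp only [pendantDist]
      split_ifs with h1 <;> try subst h1
      all_goals omega
    · obtain rfl : i = j := h
      simp only [pendantDist]
      split_ifs with h1 <;> try subst h1
      all_goals omega
    · obtain ⟨rfl, h1, h2⟩ := h
      simp only [pendantDist]
      split_ifs <;> omega
  · rintro ⟨i, _ | x⟩ hv
    · rcases lt_trichotomy i.val e.val with h | h | h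
      · refine ⟨⟨⟨i.val + 1, by omega⟩, none⟩, Or.inl rfl, ?_⟩
        simp only [pendantDist]
        omega
      · obtain rfl := Fin.ext h
        exact ⟨⟨i, some k⟩, rfl, by simp [pendantDist]⟩
      · refine ⟨⟨⟨i.val - 1, by omega⟩, none⟩, Or.inr ?_, ?_⟩
        · change i.val - 1 + 1 = i.val
          omega
        · simp only [pendantDist]
          omega
    · by_cases hi : i = e
      · subst hi
        have hx : x.val ≠ k.val := fun h => hv (by rw [Fin.ext h])
        by_cases hs : i ∈ star
        · exact ⟨⟨i, none⟩, rfl, by simp [pendantDist, hs, hx]⟩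
        · exact ⟨⟨i, some k⟩, ⟨rfl, hs, hx⟩, by simp [pendantDist, hs, hx]⟩
      · exact ⟨⟨i, none⟩, rfl, by simp [pendantDist, hi]⟩

theorem caterpillar_connected (ha : 0 < a) : (caterpillar r star).Connected := by
  have : Nonempty (CaterpillarVertex r) := ⟨⟨⟨0, ha⟩, none⟩⟩
  exact ⟨fun u v => (caterpillar_dist ⟨0, ha⟩ 0 u).1.trans (caterpillar_dist ⟨0, ha⟩ 0 v).1.symm⟩

/-- The vertices of `S` in the `i`-th branch of the caterpillar. -/
def branch (S : Finset (CaterpillarVertex r)) (i : Fin a) : Finset (Option (Fin (r i + 1))) :=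
  {o | ⟨i, o⟩ ∈ S}

theorem mem_branch {S : Finset (CaterpillarVertex r)} {i : Fin a} {o : Option (Fin (r i + 1))} :
    o ∈ branch S i ↔ ⟨i, o⟩ ∈ S := by
  simp [branch]

theorem card_eq_sum_branch (S : Finset (CaterpillarVertex r)) :
    S.card = ∑ i, (branch S i).card := by
  rw [← Finset.card_sigma]
  congr 1
  ext ⟨i, o⟩
  simp [mem_branch]

theorem card_add_card_compl_branch (S : Finset (CaterpillarVertex r)) (i : Fin a) :
    (branch S i).card + (branch S i)ᶜ.card = r i + 2 := by
  rw [Finset.card_add_card_compl, Fintype.card_option, Fintype.card_fin]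

theorem IsDominating.branch_card_pos {S : Finset (CaterpillarVertex r)}
    (hS : IsDominating (caterpillar r star) S) (i : Fin a) : 1 ≤ (branch S i).card := by
  rw [Nat.succ_le_iff, Finset.card_pos]
  by_cases h : (⟨i, some 0⟩ : CaterpillarVertex r) ∈ S
  · exact ⟨_, mem_branch.2 h⟩
  · obtain ⟨⟨j, _ | y⟩, hw, hadj⟩ := isDominating_iff.1 hS _ h
    · obtain rfl : i = j := hadj
      exact ⟨_, mem_branch.2 hw⟩
    · obtain ⟨rfl, -⟩ := hadj
      exact ⟨_, mem_branch.2 hw⟩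

theorem IsLocating.pendant_eq (ha : 0 < a) {S : Finset (CaterpillarVertex r)}
    (hS : IsLocating (caterpillar r star) S) {i : Fin a} {x y : Fin (r i + 1)}
    (hx : (⟨i, some x⟩ : CaterpillarVertex r) ∉ S)
    (hy : (⟨i, some y⟩ : CaterpillarVertex r) ∉ S) : x = y := by
  have h : (⟨i, some x⟩ : CaterpillarVertex r) = ⟨i, some y⟩ := by
    refine hS.eq_of_twins (caterpillar_connected ha) hx hy ?_
    rintro ⟨j, _ | z⟩ h1 h2
    · exact Iff.rfl
    · change _ ∧ _ ↔ _ ∧ _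
      refine and_congr_right ?_
      rintro rfl
      refine and_congr_right fun _ => ?_
      have hzx : z ≠ x := by rintro rfl; exact h1 rfl
      have hzy : z ≠ y := by rintro rfl; exact h2 rfl
      exact iff_of_true (fun h => hzx (Fin.ext h.symm)) (fun h => hzy (Fin.ext h.symm))
  simpa using h

theorem IsLocating.le_branch_card (ha : 0 < a) {S : Finset (CaterpillarVertex r)}
    (hS : IsLocating (caterpillar r star) S) (i : Fin a) : r i ≤ (branch S i).card := by
  have h1 : ((branch S i)ᶜ.erase none).card ≤ 1 := by
    refine Finset.card_le_one.2 ?_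
    rintro (_ | x) hx (_ | y) hy
    · rfl
    · simp at hx
    · simp at hy
    · simp only [Finset.mem_erase, Finset.mem_compl, mem_branch] at hx hy
      rw [hS.pendant_eq ha hx.2 hy.2]
  -- Besides one pendant vertex, the spine vertex may be missed too: `r i + 2` minus two.
  have h2 := Finset.pred_card_le_card_erase (s := (branch S i)ᶜ) (a := none)
  have h3 := card_add_card_compl_branch S i
  omega

/-- In a star branch a missed pendant vertex can only be dominated by the spine vertex, so at most
one vertex of the whole branch is missed. -/
theorem IsMetricLocatingDominating.lt_branch_card (ha : 0 < a) {S : Finset (CaterpillarVertex r)}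
    (hS : IsMetricLocatingDominating (caterpillar r star) S) {i : Fin a} (hi : i ∈ star) :
    r i + 1 ≤ (branch S i).card := by
  have hdom : ∀ x, (⟨i, some x⟩ : CaterpillarVertex r) ∉ S →
      (⟨i, none⟩ : CaterpillarVertex r) ∈ S := by
    intro x hx
    obtain ⟨⟨j, _ | y⟩, hw, hadj⟩ := isDominating_iff.1 hS.2 _ hx
    · obtain rfl : i = j := hadj
      exact hw
    · exact absurd hi hadj.2.1
  have h1 : (branch S i)ᶜ.card ≤ 1 := by
    refine Finset.card_le_one.2 ?_
    simp only [Finset.mem_compl, mem_branch]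
    rintro (_ | x) hx (_ | y) hy
    · rfl
    · exact absurd (hdom y hy) hx
    · exact absurd (hdom x hx) hy
    · rw [hS.1.pendant_eq ha hx hy]
  have h3 := card_add_card_compl_branch S i
  omega

/-- All pendant vertices but one in each branch, together with the spine vertices in `T`. -/
def landmarks (r : Fin a → ℕ) (T : Finset (Fin a)) : Finset (CaterpillarVertex r) :=
  Finset.univ.sigma fun i =>
    if i ∈ T then Finset.univ.erase (some 0) else (Finset.univ.erase (some 0)).erase none

theorem mem_landmarks {T : Finset (Fin a)} {i : Fin a} {o : Option (Fin (r i + 1))} :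
    (⟨i, o⟩ : CaterpillarVertex r) ∈ landmarks r T ↔ o ≠ some 0 ∧ (o = none → i ∈ T) := by
  by_cases h : i ∈ T <;> simp [landmarks, h, and_comm]

theorem card_landmarks (T : Finset (Fin a)) :
    (landmarks r T).card = ∑ i, r i + T.card := by
  have h : ∀ i, (if i ∈ T then Finset.univ.erase (some 0) else
      (Finset.univ.erase (some (0 : Fin (r i + 1)))).erase none).card =
        r i + if i ∈ T then 1 else 0 := by
    intro i
    split_ifs <;> simp
  rw [landmarks, Finset.card_sigma, Finset.sum_congr rfl fun i _ => h i, Finset.sum_add_distrib]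
  simp

/-- Landmarks in the two end branches suffice: their distances determine the branch, and their sum
is `a + 1` at spine vertices but larger at missed pendant ones. If `a = 1`, a clique branch would
make the graph complete, with the spine vertex a further twin; `hone` rules this out. -/
theorem isLocating_landmarks (ha : 0 < a)
    (hfirst : 0 < r ⟨0, ha⟩) (hlast : 0 < r ⟨a - 1, by omega⟩)
    (hone : a = 1 → ⟨0, ha⟩ ∈ star) : IsLocating (caterpillar r star) (landmarks r ∅) := by
  have hd := @caterpillar_dist a r star
  have hmem : ∀ (e : Fin a) (h : 0 < r e),
      (⟨e, some ⟨1, by omega⟩⟩ : CaterpillarVertex r) ∈ landmarks r ∅ := by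
    intro e h
    rw [mem_landmarks]
    exact ⟨fun h' => by simpa using congrArg Fin.val (Option.some.inj h'), by simp⟩
  refine isLocating_of_notMem (caterpillar_connected ha) fun u hu v hv huv => ?_
  by_contra! hcon
  have h1 := hcon _ (hmem _ hfirst)
  have h2 := hcon _ (hmem _ hlast)
  rw [(hd _ _ u).2, (hd _ _ v).2] at h1 h2
  have hform : ∀ (i : Fin a) (o : Option (Fin (r i + 1))),
      (⟨i, o⟩ : CaterpillarVertex r) ∉ landmarks r ∅ → o = none ∨ o = some 0 := by
    intro i o h
    rw [mem_landmarks] at h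
    rcases o with _ | x
    · exact Or.inl rfl
    · right
      by_contra h'
      exact h ⟨h', by simp⟩
  obtain ⟨i, o⟩ := u
  obtain ⟨j, o'⟩ := v
  have hi := i.isLt
  have hj := j.isLt
  have hone' : a = 1 → ∀ i : Fin a, i ∈ star := by
    rintro rfl i
    rw [Subsingleton.elim i ⟨0, ha⟩]
    exact hone rfl
  have key : i = j → (o = none ↔ o' = none) → False := by
    rintro rfl h
    apply huv
    rcases hform _ _ hu with rfl | rfl <;> rcases hform _ _ hv with rfl | rfl <;> simp_all
  rw [Fin.ext_iff] at key
  -- The second alternative is the shortcut inside an end branch that is a clique.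
  have hval : ∀ e i : Fin a, pendantDist r star e 1 ⟨i, some 0⟩ =
      (i.val - e.val) + (e.val - i.val) + 2 ∨
        i.val = e.val ∧ a ≠ 1 ∧ pendantDist r star e 1 ⟨i, some 0⟩ = 1 := by
    intro e i
    simp only [pendantDist, Fin.val_zero]
    split_ifs with h3 h4 h5
    · simp at h4
    · subst h3
      exact Or.inl (by omega)
    · exact Or.inr ⟨congrArg _ h3, fun h => h5 (hone' h i), rfl⟩
    · exact Or.inl rfl
  have hnone : ∀ e i : Fin a, pendantDist r star e 1 ⟨i, none⟩ =
      (i.val - e.val) + (e.val - i.val) + 1 := fun _ _ => rfl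
  have hi1 := hval ⟨0, ha⟩ i
  have hi2 := hval ⟨a - 1, by omega⟩ i
  have hj1 := hval ⟨0, ha⟩ j
  have hj2 := hval ⟨a - 1, by omega⟩ j
  rcases hform _ _ hu with rfl | rfl <;> rcases hform _ _ hv with rfl | rfl <;>
    simp only [hnone] at h1 h2 hi1 hi2 hj1 hj2 <;>
    simp only [reduceCtorEq, iff_true, iff_false, not_true, imp_false] at key <;> omega

theorem hasNumbers_caterpillar (ha : 0 < a)
    (hfirst : 0 < r ⟨0, ha⟩) (hlast : 0 < r ⟨a - 1, by omega⟩)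
    (hone : a = 1 → ⟨0, ha⟩ ∈ star) (hclique : ∀ i ∉ star, 0 < r i) :
    HasNumbers (caterpillar r star) a (∑ i, r i) (∑ i, r i + star.card) := by
  have hloc := isLocating_landmarks ha hfirst hlast hone
  refine hasNumbers_of (caterpillar_connected ha) ?_ ?_ ⟨_, hloc, by simp [card_landmarks]⟩ ?_
    ⟨landmarks r star, ⟨hloc.mono ?_, ?_⟩, card_landmarks star⟩ ?_
  · refine ⟨Finset.univ.sigma fun _ => {none}, isDominating_iff.2 ?_, by simp⟩
    rintro ⟨i, _ | x⟩ h
    · simp at h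
    · exact ⟨⟨i, none⟩, by simp, rfl⟩
  · intro D hD
    rw [card_eq_sum_branch]
    simpa using Finset.sum_le_sum fun i (_ : i ∈ Finset.univ) => hD.branch_card_pos i
  · intro D hD
    rw [card_eq_sum_branch]
    exact Finset.sum_le_sum fun i _ => hD.le_branch_card ha i
  · rintro ⟨i, o⟩ h
    rw [mem_landmarks] at h ⊢
    exact ⟨h.1, fun ho => absurd (h.2 ho) (Finset.notMem_empty i)⟩
  · rw [isDominating_iff]
    rintro ⟨i, o⟩ h
    rw [mem_landmarks] at h
    by_cases hi : i ∈ star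
    · obtain rfl : o = some 0 := by
        by_contra h'
        exact h ⟨h', fun _ => hi⟩
      exact ⟨⟨i, none⟩, mem_landmarks.2 ⟨by simp, fun _ => hi⟩, rfl⟩
    · refine ⟨⟨i, some ⟨1, by have := hclique i hi; omega⟩⟩, mem_landmarks.2 ⟨?_, by simp⟩, ?_⟩
      · exact fun h' => by simpa using congrArg Fin.val (Option.some.inj h')
      · rcases o with _ | x
        · rfl
        · obtain rfl : x = 0 := by
            by_contra h'
            exact h ⟨by simpa using h', by simp⟩
          exact ⟨rfl, hi, by simp⟩
  · intro D hD
    have h : ∑ i, r i + star.card = ∑ i, (r i + if i ∈ star then 1 else 0) := by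
      simp [Finset.sum_add_distrib]
    rw [card_eq_sum_branch, h]
    refine Finset.sum_le_sum fun i _ => ?_
    split_ifs with hi
    · exact hD.lt_branch_card ha hi
    · exact hD.1.le_branch_card ha i

end Caterpillar

/-! ### Choice of the parameters -/

theorem exists_hasNumbers_caterpillar {a b c : ℕ} (ha : 1 < a) (hb : 1 < b) (hac : a ≤ c)
    (hbc : b ≤ c) (hc : c ≤ a + b) :
    ∃ (n : ℕ) (G : SimpleGraph (Fin n)), HasNumbers G a b c := by
  let p : Fin a := ⟨0, by omega⟩
  let q : Fin a := ⟨a - 1, by omega⟩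
  have hpq : p ≠ q := fun h => by
    have : 0 = a - 1 := congrArg Fin.val h
    omega
  have hcard : ({p, q} : Finset (Fin a)).card = 2 := Finset.card_pair hpq
  -- `Q` indexes the clique branches, leaving `c - b` stars. `T` collects the branches that need `r
  -- i > 0`, namely `Q` and both ends; what remains of `b` goes to `p`.
  obtain ⟨Q, hQ, T, hpqT, hQT, hT⟩ : ∃ Q : Finset (Fin a), Q.card = a + b - c ∧
      ∃ T : Finset (Fin a), {p, q} ⊆ T ∧ Q ⊆ T ∧ T.card ≤ b := by
    rcases le_total (a + b - c) 2 with h | h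
    · obtain ⟨Q, hQs, hQ⟩ := Finset.exists_subset_card_eq (hcard.symm ▸ h)
      exact ⟨Q, hQ, {p, q}, subset_rfl, hQs, by omega⟩
    · obtain ⟨Q, hQs, -, hQ⟩ := Finset.exists_subsuperset_card_eq
        (Finset.subset_univ ({p, q} : Finset (Fin a))) (hcard.symm ▸ h) (by simp; omega)
      exact ⟨Q, hQ, Q, hQs, subset_rfl, by omega⟩
  let r : Fin a → ℕ := fun i => (if i ∈ T then 1 else 0) + if i = p then b - T.card else 0
  have hr : ∀ i ∈ T, 0 < r i := fun i hi => by simp [r, hi]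
  have hsum : ∑ i, r i = b := by
    simp only [r, Finset.sum_add_distrib, Finset.sum_ite_eq', Finset.sum_ite_mem]
    simp
    omega
  have h := hasNumbers_caterpillar (r := r) (star := Qᶜ) (by omega)
    (hr p (hpqT (by simp))) (hr q (hpqT (by simp))) (by omega)
    (fun i hi => hr i (hQT (by simpa using hi)))
  rw [hsum, Finset.card_compl, hQ, Fintype.card_fin, show b + (a - (a + b - c)) = c by omega] at h
  exact h.exists_fin

theorem exists_hasNumbers_star {b : ℕ} (hb : 0 < b) :
    ∃ (n : ℕ) (G : SimpleGraph (Fin n)), HasNumbers G 1 b (b + 1) := by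
  have h := hasNumbers_caterpillar (a := 1) (r := fun _ => b) (star := Finset.univ) one_pos
    hb hb (by simp) (by simp)
  simp only [Finset.univ_unique, Finset.sum_singleton, Finset.card_singleton] at h
  exact h.exists_fin

end CodeGraph

theorem theorem5 (a b c : ℕ) (ha : 0 < a) (hb : 0 < b) (hc : 0 < c)
    (hlo : max a b ≤ c) (hhi : c ≤ a + b) :
    (¬ (b = 1 ∧ 1 < a ∧ c = a + 1) →
      ∃ (n : ℕ) (G : SimpleGraph (Fin n)), G.Connected ∧
        CodeGraph.dominationNumber G = a ∧
        CodeGraph.metricDimension G = b ∧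
        CodeGraph.metricLocationDominationNumber G = c) ∧
    (b = 1 ∧ 1 < a ∧ c = a + 1 →
      ∀ (V : Type*) [Finite V] (G : SimpleGraph V), G.Connected →
        ¬ (CodeGraph.dominationNumber G = a ∧
          CodeGraph.metricDimension G = b ∧
          CodeGraph.metricLocationDominationNumber G = c)) := by
  obtain ⟨hac, hbc⟩ := max_le_iff.1 hlo
  constructor
  · intro hne
    change ∃ (n : ℕ) (G : SimpleGraph (Fin n)), CodeGraph.HasNumbers G a b c
    rcases (Nat.succ_le_iff.2 ha).eq_or_lt with rfl | ha1
    · obtain rfl | rfl : c = b ∨ c = b + 1 := by omega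
      · exact ⟨_, _, CodeGraph.hasNumbers_top hb⟩
      · exact CodeGraph.exists_hasNumbers_star hb
    · rcases (Nat.succ_le_iff.2 hb).eq_or_lt with rfl | hb1
      · obtain rfl : c = a := by omega
        exact ⟨_, _, CodeGraph.hasNumbers_pathGraph ha1⟩
      · exact CodeGraph.exists_hasNumbers_caterpillar ha1 hb1 hac hbc hhi
  · rintro ⟨rfl, ha1, rfl⟩ V _ G hG ⟨h1, h2, h3⟩
    have := CodeGraph.metricLocationDominationNumber_eq_of_metricDimension_eq_one hG h2
      (by omega)
    omega
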